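/- Let $\mu$ be the uniform distribution on the unit circle $\{z\in\mathbb{C}:|z|=1\}$, regarded as a Borel probability measure on $\mathbb{C}$, and let $Z_1,Z_2,\dots$ be independent complex-valued random variables on a probability space $(\Omega,\mathbb{P})$, each with law $\mu$. Fix an integer $k\ge 1$. For $n\ge k+1$ and $\omega\in\Omega$ let $$P_n(\omega)(z)=(z-Z_1(\omega))\cdots(z-Z_n(\omega)),$$ let $W^{(k)}_{n,1}(\omega),\dots,W^{(k)}_{n,n-k}(\omega)$ be the zeros, counted with multiplicity, of the $k$-th derivative $P_n(\omega)^{(k)}$, and let $$\mu^{(k)}_n(\omega)=\frac{1}{n-k}\sum_{j=1}^{n-k}\delta_{W^{(k)}_{n,j}(\omega)}$$ be their empirical measure, where $\delta_w$ is the Dirac measure at $w$. Then almost surely $\mu^{(k)}_n$ converges weakly to $\mu$ as $n\to\infty$; that is, for $\mathbb{P}$-almost every $\omega$, the probability measures $\mu^{(k)}_n(\omega)$ on $\mathbb{C}$ converge weakly to $\mu$. -/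

import Mathlib

open MeasureTheory ProbabilityTheory Filter Topology Polynomial

noncomputable section

/-- The uniform distribution on the unit circle, as a probability measure on `ℂ`: the law of
`exp (i θ)` where `θ` is uniformly distributed on `(0, 2π]`. -/
def uniformCircle : ProbabilityMeasure ℂ :=
  ⟨(volume[|Set.Ioc (0 : ℝ) (2 * Real.pi)]).map (fun θ : ℝ => Complex.exp (θ * Complex.I)), by
    have h : IsProbabilityMeasure (volume[|Set.Ioc (0 : ℝ) (2 * Real.pi)]) := by
      apply cond_isProbabilityMeasure_of_finite
      · simp [Real.pi_pos]
      · exact measure_Ioc_lt_top.ne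
    exact Measure.isProbabilityMeasure_map (by fun_prop)⟩

/-- The random polynomial `P_n(ω)(z) = (z - Z_0(ω)) ⋯ (z - Z_{n-1}(ω))`. -/
def randomPoly {Ω : Type*} (Z : ℕ → Ω → ℂ) (n : ℕ) (ω : Ω) : ℂ[X] :=
  ∏ i ∈ Finset.range n, (X - C (Z i ω))

/-- The zeros in `ℂ`, counted with multiplicity, of the `k`-th derivative of `P_n(ω)`. -/
def derivZeros {Ω : Type*} (Z : ℕ → Ω → ℂ) (k n : ℕ) (ω : Ω) : Multiset ℂ :=
  (derivative^[k] (randomPoly Z n ω)).roots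

theorem card_derivZeros {Ω : Type*} (Z : ℕ → Ω → ℂ) (k n : ℕ) (ω : Ω) :
    Multiset.card (derivZeros Z k n ω) = n - k := by
  have hd : ∀ j : ℕ, (derivative^[j] (randomPoly Z n ω)).natDegree = n - j := by
    intro j
    induction j with
    | zero => simp [randomPoly]
    | succ j ih =>
      rw [Function.iterate_succ_apply', natDegree_derivative, ih, Nat.sub_sub]
  rw [derivZeros, ← (IsAlgClosed.splits _).natDegree_eq_card_roots, hd]

/-- The empirical measure `(n - k)⁻¹ ∑_j δ_{W_j}` of the `n - k` zeros `W_j`, counted with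
multiplicity, of the `k`-th derivative of `P_n(ω)`, for `k < n`. -/
def empiricalMeasure {Ω : Type*} (Z : ℕ → Ω → ℂ) (k n : ℕ) (hkn : k < n) (ω : Ω) :
    ProbabilityMeasure ℂ :=
  ⟨((n - k : ℕ) : ENNReal)⁻¹ • ((derivZeros Z k n ω).map Measure.dirac).sum, by
    have key : ∀ s : Multiset ℂ,
        (s.map Measure.dirac).sum Set.univ = (Multiset.card s : ENNReal) := by
      intro s
      induction s using Multiset.induction_on with
      | empty => simp
      | cons a s ih => simp [ih, add_comm]
    constructor
    rw [Measure.smul_apply, key, card_derivZeros, smul_eq_mul]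
    apply ENNReal.inv_mul_cancel
    · exact_mod_cast (Nat.sub_pos_of_lt hkn).ne'
    · exact ENNReal.natCast_ne_top _⟩

end

/-! Method of moments. Almost surely all `Z i` lie on the unit circle, so by Gauss–Lucas the zeros
of every derivative lie in the closed unit disc. There weak convergence follows from convergence of
the mixed moments of `z` and its conjugate (`tendsto_probabilityMeasure_of_tendsto_moments`), and
those of the uniform law are 1 if `a = b` and 0 otherwise.

Holomorphic moments: for fixed `m ≥ 1`, differentiation changes the `m`-th power sum of the zeros by
an amount bounded independently of the degree (`norm_powSum_roots_sub_le`). The strong law gives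
that the averages of `Z i ^ m` tend to 0, hence so do those over the zeros of the `k`-th derivative.

Mixed moments: these reduce to holomorphic ones once the average of `1 - ‖w‖` over the zeros `w`
tends to 0. By Vieta, the product of the zeros is, up to sign and a factor polynomial in `n`, the
coefficient of `X ^ k` in `P_n`, while its modulus is at most `exp (-∑ (1 - ‖w‖))`. So it is enough
that this coefficient is eventually at least `exp (-ε n)` for every `ε > 0`. This comes from an
anti-concentration bound, proved by induction on `k` (`measure_norm_coeff_randomPoly_le`), and
Borel–Cantelli. -/

/-! ### Generating series of power sums, and their change under differentiation. -/

/-- The power series `∏ (1 - a X)` over the elements `a` of a multiset. -/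
noncomputable def revProd (s : Multiset ℂ) : PowerSeries ℂ :=
  (s.map fun a => 1 - PowerSeries.C a * PowerSeries.X).prod

/-- The `m`-th power sum of a multiset. -/
noncomputable def powSum (s : Multiset ℂ) (m : ℕ) : ℂ := (s.map (· ^ m)).sum

/-- The generating series of the power sums of a multiset. -/
noncomputable def powSumSeries (s : Multiset ℂ) : PowerSeries ℂ := PowerSeries.mk (powSum s)

theorem powSum_zero (s : Multiset ℂ) : powSum s 0 = Multiset.card s := by simp [powSum]

theorem powSum_cons (a : ℂ) (s : Multiset ℂ) (m : ℕ) :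
    powSum (a ::ₘ s) m = a ^ m + powSum s m := by simp [powSum]

theorem norm_powSum_le {s : Multiset ℂ} (h : ∀ a ∈ s, ‖a‖ ≤ 1) (m : ℕ) :
    ‖powSum s m‖ ≤ Multiset.card s := by
  induction s using Multiset.induction_on with
  | empty => simp [powSum]
  | cons a s ih =>
    rw [powSum_cons, Multiset.card_cons]
    have h1 : ‖a ^ m‖ ≤ 1 := by
      rw [norm_pow]; exact pow_le_one₀ (norm_nonneg _) (h a (by simp))
    have h2 := ih fun b hb => h b (by simp [hb])
    push_cast
    linarith [norm_add_le (a ^ m) (powSum s m)]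

theorem one_sub_mul_mk_pow (a : ℂ) :
    (1 - PowerSeries.C a * PowerSeries.X) * PowerSeries.mk (a ^ ·) = 1 := by
  ext n
  rcases n with _ | n
  · simp [sub_mul, mul_assoc]
  · simp [sub_mul, mul_assoc, PowerSeries.coeff_succ_X_mul, PowerSeries.coeff_one, pow_succ']

/-- Newton's identities: this is the logarithmic derivative of `∏ (1 - a X)`, cleared of
denominators. -/
theorem revProd_mul_powSumSeries_sub_card (s : Multiset ℂ) :
    revProd s * (powSumSeries s - (Multiset.card s : PowerSeries ℂ)) =
      -(PowerSeries.X * PowerSeries.derivative ℂ (revProd s)) := by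
  induction s using Multiset.induction_on with
  | empty =>
    have : powSumSeries 0 = 0 := by ext; simp [powSumSeries, powSum]
    simp [revProd, this]
  | cons a s ih =>
    have h1 : revProd (a ::ₘ s) = (1 - PowerSeries.C a * PowerSeries.X) * revProd s := by
      simp [revProd]
    have h2 : powSumSeries (a ::ₘ s) = PowerSeries.mk (a ^ ·) + powSumSeries s := by
      ext m; simp [powSumSeries, powSum_cons]
    have h3 : PowerSeries.derivative ℂ (1 - PowerSeries.C a * PowerSeries.X) =
        - PowerSeries.C a := by
      rw [map_sub, Derivation.leibniz]
      simp [PowerSeries.derivative_C]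
    have h4 := one_sub_mul_mk_pow a
    rw [h1, h2, Derivation.leibniz, h3, Multiset.card_cons]
    push_cast
    simp only [smul_eq_mul]
    linear_combination (1 - PowerSeries.C a * PowerSeries.X) * ih + revProd s * h4

/-- Reversal is multiplicative and sends `X - a` to `1 - a X`. A root at 0 contributes the factor 1,
so it needs no separate treatment. -/
theorem coe_reverse_eq (p : ℂ[X]) :
    (p.reverse : PowerSeries ℂ) = PowerSeries.C p.leadingCoeff * revProd p.roots := by
  have key : ∀ s : Multiset ℂ,
      (((s.map fun a => X - C a).prod.reverse : ℂ[X]) : PowerSeries ℂ) = revProd s := by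
    intro s
    induction s using Multiset.induction_on with
    | empty => simpa [revProd] using congrArg ((↑) : ℂ[X] → PowerSeries ℂ) (reverse_C (1 : ℂ))
    | cons a s ih =>
      have h : (X - C a : ℂ[X]).reverse = 1 - C a * X := by
        ext n
        rw [coeff_reverse, natDegree_X_sub_C]
        rcases n with _ | _ | n
        · simp [revAt_le]
        · simp [revAt_le, coeff_one]
        · rw [revAt_eq_self_of_lt (by omega)]
          simp [coeff_X, coeff_one]
      rw [Multiset.map_cons, Multiset.prod_cons, reverse_mul_of_domain, h, Polynomial.coe_mul, ih]
      simp [revProd]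
  conv_lhs => rw [(IsAlgClosed.splits p).eq_prod_roots]
  rw [reverse_mul_of_domain, reverse_C, Polynomial.coe_mul, key, Polynomial.coe_C]

theorem natDegree_mul_revProd_roots_derivative {p : ℂ[X]} (hp : 1 ≤ p.natDegree) :
    (p.natDegree : PowerSeries ℂ) * revProd p.derivative.roots =
      revProd p.roots * powSumSeries p.roots := by
  have hp0 : p ≠ 0 := by rintro rfl; simp at hp
  have hlc : (PowerSeries.C p.leadingCoeff : PowerSeries ℂ) ≠ 0 := by
    simpa using hp0
  have hcard : Multiset.card p.roots = p.natDegree :=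
    (IsAlgClosed.splits p).natDegree_eq_card_roots.symm
  have hlc' : p.derivative.leadingCoeff = p.natDegree * p.leadingCoeff := by
    rw [leadingCoeff, natDegree_derivative, coeff_derivative, Nat.sub_add_cancel hp,
      coeff_natDegree, Nat.cast_sub hp]
    push_cast
    ring
  -- With `n` the degree and `c` the coefficients of `p`, both sides have `j`-th coefficient `(n -
  -- j) c_{n-j}` for `j < n` and 0 for `j ≥ n`.
  have hrev : (p.derivative.reverse : PowerSeries ℂ) =
      (p.natDegree : PowerSeries ℂ) * (p.reverse : PowerSeries ℂ) -
        PowerSeries.X * PowerSeries.derivative ℂ (p.reverse : PowerSeries ℂ) := by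
    ext j
    rw [map_sub, ← map_natCast (PowerSeries.C (R := ℂ)), PowerSeries.coeff_C_mul,
      Polynomial.coeff_coe, Polynomial.coeff_coe, coeff_reverse, natDegree_derivative]
    have hX : PowerSeries.coeff j (PowerSeries.X *
        PowerSeries.derivative ℂ (p.reverse : PowerSeries ℂ)) = j * p.reverse.coeff j := by
      rcases j with _ | j
      · simp
      · rw [PowerSeries.coeff_succ_X_mul, PowerSeries.coeff_derivative, Polynomial.coeff_coe]
        push_cast
        ring
    rw [hX, coeff_reverse]
    rcases lt_trichotomy j p.natDegree with h | h | h
    · rw [revAt_le (by omega), revAt_le h.le, coeff_derivative,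
        show p.natDegree - 1 - j + 1 = p.natDegree - j by omega,
        show p.natDegree - 1 - j = p.natDegree - j - 1 by omega,
        Nat.cast_sub (by omega : 1 ≤ p.natDegree - j), Nat.cast_sub h.le]
      push_cast
      ring
    · rw [revAt_eq_self_of_lt (by omega), coeff_derivative,
        coeff_eq_zero_of_natDegree_lt (by omega), h]
      ring
    · rw [revAt_eq_self_of_lt (by omega), revAt_eq_self_of_lt h, coeff_derivative,
        coeff_eq_zero_of_natDegree_lt (by omega), coeff_eq_zero_of_natDegree_lt h]
      ring
  rw [coe_reverse_eq, coe_reverse_eq, hlc', Derivation.leibniz] at hrev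
  apply mul_left_cancel₀ hlc
  have := revProd_mul_powSumSeries_sub_card p.roots
  rw [hcard] at this
  simp [PowerSeries.derivative_C] at hrev
  linear_combination hrev - PowerSeries.C p.leadingCoeff * this

/-- Write `S`, `T` for the power sum series of the roots of `p` and `p'`, and `R`, `R₁` for the
corresponding `revProd`. Taking the logarithmic derivative of `n R₁ = R S` and applying Newton's
identities to `R` and `R₁` gives `S - T - 1 = X S' / S`. -/
theorem powSumSeries_mul_eq {p : ℂ[X]} (hp : 1 ≤ p.natDegree) :
    powSumSeries p.roots * (powSumSeries p.roots - powSumSeries p.derivative.roots - 1) =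
      PowerSeries.X * PowerSeries.derivative ℂ (powSumSeries p.roots) := by
  have hcard : Multiset.card p.roots = p.natDegree :=
    (IsAlgClosed.splits p).natDegree_eq_card_roots.symm
  have hcard' : Multiset.card p.derivative.roots = p.natDegree - 1 := by
    rw [← (IsAlgClosed.splits _).natDegree_eq_card_roots, natDegree_derivative]
  have h1 := natDegree_mul_revProd_roots_derivative hp
  have h2 := revProd_mul_powSumSeries_sub_card p.roots
  have h3 := revProd_mul_powSumSeries_sub_card p.derivative.roots
  have h4 := congrArg (PowerSeries.derivative ℂ) h1
  rw [Derivation.leibniz, Derivation.leibniz, Derivation.map_natCast] at h4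
  rw [hcard] at h2
  rw [hcard', Nat.cast_sub hp] at h3
  have hne : revProd p.roots ≠ 0 := by
    rw [revProd, Ne, Multiset.prod_eq_zero_iff]
    simp only [Multiset.mem_map, not_exists, not_and]
    intro a _ h
    have := one_sub_mul_mk_pow a
    rw [h] at this
    simp at this
  apply mul_left_cancel₀ hne
  simp only [smul_eq_mul] at h4
  push_cast at h3
  linear_combination (powSumSeries p.derivative.roots - p.natDegree + 1) * h1
    + powSumSeries p.roots * h2 - p.natDegree * h3  + PowerSeries.X * h4

/-- Let `p_i` be the power sums of the roots and `d_i` their differences with those of the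
derivative. The coefficient of `X ^ (m + 1)` in `powSumSeries_mul_eq` reads `n d_{m+1} = (m + 1)
p_{m+1} - ∑_{i=1}^{m} p_i d_{m+1-i}`. Since `‖p_i‖ ≤ n`, dividing by `n` bounds `d_{m+1}` by earlier
bounds, independently of `n`. -/
theorem norm_powSum_roots_sub_le (m : ℕ) : ∃ c : ℝ, ∀ p : ℂ[X], 1 ≤ p.natDegree →
    (∀ a ∈ p.roots, ‖a‖ ≤ 1) → ∀ j ≤ m, 1 ≤ j →
      ‖powSum p.roots j - powSum p.derivative.roots j‖ ≤ c := by
  induction m with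
  | zero => exact ⟨0, by intros; omega⟩
  | succ m ih =>
    obtain ⟨c, hc⟩ := ih
    refine ⟨max c ((m + 1) + m * max c 0), fun p hp hroots j hj hj1 => ?_⟩
    rcases Nat.le_succ_iff.1 hj with hj | rfl
    · exact (hc p hp hroots j hj hj1).trans (le_max_left _ _)
    · refine le_trans ?_ (le_max_right _ _)
      have hcard : Multiset.card p.roots = p.natDegree :=
        (IsAlgClosed.splits p).natDegree_eq_card_roots.symm
      have hcard' : Multiset.card p.derivative.roots = p.natDegree - 1 := by
        rw [← (IsAlgClosed.splits _).natDegree_eq_card_roots, natDegree_derivative]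
      have hn : (0 : ℝ) < p.natDegree := by exact_mod_cast hp
      have hA : ∀ i, ‖powSum p.roots i‖ ≤ p.natDegree := fun i => by
        rw [← hcard]; exact norm_powSum_le hroots i
      have h := congrArg (PowerSeries.coeff (m + 1)) (powSumSeries_mul_eq hp)
      rw [PowerSeries.coeff_succ_X_mul, PowerSeries.coeff_derivative, PowerSeries.coeff_mul,
        Finset.Nat.sum_antidiagonal_eq_sum_range_succ_mk, Finset.sum_range_succ,
        Finset.sum_range_succ'] at h
      -- Differentiation loses exactly one root, so `S - T - 1` has no constant term and the last
      -- term of the convolution drops out.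
      have h0 : (p.natDegree : ℂ) - (p.natDegree - 1 : ℕ) - 1 = 0 := by
        rw [Nat.cast_sub hp]; push_cast; ring
      simp only [powSumSeries, map_sub, PowerSeries.coeff_mk, PowerSeries.coeff_one, Nat.sub_self,
        powSum_zero, hcard, hcard', Nat.sub_zero, if_true, h0, mul_zero, add_zero,
        Nat.succ_ne_zero, if_false, sub_zero, Nat.add_sub_add_right] at h
      have hsum : ‖∑ i ∈ Finset.range m, powSum p.roots (i + 1) *
          (powSum p.roots (m - i) - powSum p.derivative.roots (m - i) - if m - i = 0 then 1 else 0)‖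
            ≤ p.natDegree * (m * max c 0) := by
        calc _ ≤ ∑ i ∈ Finset.range m, (p.natDegree : ℝ) * max c 0 := by
              refine norm_sum_le_of_le _ fun i hi => ?_
              have hi := Finset.mem_range.1 hi
              rw [if_neg (by omega), sub_zero, norm_mul]
              exact mul_le_mul (hA _) ((hc p hp hroots _ (by omega) (by omega)).trans
                (le_max_left _ _)) (norm_nonneg _) hn.le
          _ = _ := by simp; ring
      have hmain : (p.natDegree : ℂ) * (powSum p.roots (m + 1) - powSum p.derivative.roots (m + 1))
          = powSum p.roots (m + 1) * (m + 1) - ∑ i ∈ Finset.range m, powSum p.roots (i + 1) *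
          (powSum p.roots (m - i) - powSum p.derivative.roots (m - i) -
            if m - i = 0 then 1 else 0) := by
        rw [← h]; ring
      have := congrArg norm hmain
      rw [norm_mul, Complex.norm_natCast] at this
      have h5 : ‖powSum p.roots (m + 1) * ((m : ℂ) + 1)‖ ≤ p.natDegree * (m + 1) := by
        rw [norm_mul]
        have : ‖(m : ℂ) + 1‖ = m + 1 := by exact_mod_cast Complex.norm_natCast (m + 1)
        rw [this]
        gcongr
        exact hA _
      refine le_of_mul_le_mul_left ?_ hn
      rw [this, mul_add (p.natDegree : ℝ)]
      exact (norm_sub_le _ _).trans (add_le_add h5 hsum)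

/-! ### Weak convergence from mixed moments. -/

/-- Probability measures on a compact subset of `ℂ` converge weakly if all their mixed moments
`∫ z ^ a * conj z ^ b` do. -/
theorem tendsto_probabilityMeasure_of_tendsto_moments {K : Set ℂ} (hK : IsCompact K)
    {ν : ℕ → ProbabilityMeasure ℂ} {μ : ProbabilityMeasure ℂ}
    (hν : ∀ m, ∀ᵐ z ∂(ν m : Measure ℂ), z ∈ K) (hμ : ∀ᵐ z ∂(μ : Measure ℂ), z ∈ K)
    (h : ∀ a b : ℕ, Tendsto (fun m => ∫ z, z ^ a * (starRingEnd ℂ z) ^ b ∂(ν m : Measure ℂ)) atTop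
      (𝓝 (∫ z, z ^ a * (starRingEnd ℂ z) ^ b ∂(μ : Measure ℂ)))) :
    Tendsto ν atTop (𝓝 μ) := by
  have : CompactSpace K := isCompact_iff_compactSpace.1 hK
  have hint : ∀ (ρ : ProbabilityMeasure ℂ), (∀ᵐ z ∂(ρ : Measure ℂ), z ∈ K) →
      ∀ G : ℂ → ℂ, Continuous G → Integrable G (ρ : Measure ℂ) := by
    intro ρ hρ G hG
    obtain ⟨c, hc⟩ := hK.exists_bound_of_continuousOn hG.continuousOn
    exact Integrable.of_bound hG.aestronglyMeasurable c (hρ.mono hc)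
  let x : C(K, ℂ) := ⟨Subtype.val, continuous_subtype_val⟩
  -- Elements of the star algebra are functions on `K`, while the measures live on `ℂ`; each is
  -- therefore carried with a continuous extension `G` to `ℂ`.
  have key : ∀ g ∈ Submodule.span ℂ ((Submonoid.closure {x, star x} : Submonoid C(K, ℂ)) :
      Set C(K, ℂ)), ∃ G : ℂ → ℂ, Continuous G ∧ (∀ z : K, G z = g z) ∧
        Tendsto (fun m => ∫ z, G z ∂(ν m : Measure ℂ)) atTop
          (𝓝 (∫ z, G z ∂(μ : Measure ℂ))) := by
    intro g hg
    induction hg using Submodule.span_induction with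
    | mem g hg =>
      obtain ⟨a, b, rfl⟩ := (Submonoid.mem_closure_pair _ _ _).1 hg
      exact ⟨fun z => z ^ a * (starRingEnd ℂ z) ^ b, by fun_prop, fun z => by simp [x], h a b⟩
    | zero => exact ⟨0, continuous_zero, by simp, by simp⟩
    | add g₁ g₂ _ _ h₁ h₂ =>
      obtain ⟨G₁, hc₁, he₁, ht₁⟩ := h₁
      obtain ⟨G₂, hc₂, he₂, ht₂⟩ := h₂
      refine ⟨fun z => G₁ z + G₂ z, hc₁.add hc₂, fun z => by simp [he₁, he₂], ?_⟩
      rw [integral_add (hint μ hμ _ hc₁) (hint μ hμ _ hc₂)]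
      refine (ht₁.add ht₂).congr fun m => ?_
      rw [integral_add (hint _ (hν m) _ hc₁) (hint _ (hν m) _ hc₂)]
    | smul c g _ h =>
      obtain ⟨G, hc, he, ht⟩ := h
      refine ⟨fun z => c * G z, hc.const_mul c, fun z => by simp [he], ?_⟩
      simp only [integral_const_mul]
      exact ht.const_mul c
  -- Stone–Weierstrass: the coordinate function alone separates points.
  have hdense : (StarAlgebra.adjoin ℂ ({x} : Set C(K, ℂ))).topologicalClosure = ⊤ := by
    apply ContinuousMap.starSubalgebra_topologicalClosure_eq_top_of_separatesPoints
    intro y z hyz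
    exact ⟨x, ⟨x, StarAlgebra.self_mem_adjoin_singleton ℂ x, rfl⟩,
      fun h => hyz (Subtype.ext h)⟩
  rw [ProbabilityMeasure.tendsto_iff_forall_integral_rclike_tendsto ℂ]
  intro f
  rw [Metric.tendsto_atTop]
  intro ε hε
  let fK : C(K, ℂ) := ⟨fun z => f z, by fun_prop⟩
  have hmem : fK ∈ closure ((StarAlgebra.adjoin ℂ ({x} : Set C(K, ℂ)) : StarSubalgebra ℂ _) :
      Set C(K, ℂ)) := by
    rw [← StarSubalgebra.topologicalClosure_coe, hdense]
    trivial
  obtain ⟨g, hg, hdist⟩ := Metric.mem_closure_iff.1 hmem (ε / 3) (by positivity)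
  have hg' : g ∈ Submodule.span ℂ ((Submonoid.closure {x, star x} : Submonoid C(K, ℂ)) :
      Set C(K, ℂ)) := by
    rw [← Algebra.adjoin_eq_span]
    have := StarAlgebra.adjoin_toSubalgebra ℂ ({x} : Set C(K, ℂ))
    rw [Set.star_singleton, Set.singleton_union] at this
    change g ∈ Algebra.adjoin ℂ {x, star x}
    rw [← this]
    exact hg
  obtain ⟨G, hGc, hGe, hGt⟩ := key g hg'
  have hclose : ∀ (ρ : ProbabilityMeasure ℂ), (∀ᵐ z ∂(ρ : Measure ℂ), z ∈ K) →
      dist (∫ z, f z ∂(ρ : Measure ℂ)) (∫ z, G z ∂(ρ : Measure ℂ)) ≤ ε / 3 := by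
    intro ρ hρ
    rw [dist_eq_norm, ← integral_sub (hint ρ hρ _ f.continuous) (hint ρ hρ _ hGc)]
    refine (norm_integral_le_of_norm_le_const (C := ε / 3) (hρ.mono fun z hz => ?_)).trans
      (by simp)
    rw [← dist_eq_norm, hGe ⟨z, hz⟩]
    exact (ContinuousMap.dist_apply_le_dist (f := fK) (g := g) ⟨z, hz⟩).trans hdist.le
  obtain ⟨N, hN⟩ := Metric.tendsto_atTop.1 hGt (ε / 3) (by positivity)
  refine ⟨N, fun m hm => ?_⟩
  have h1 := hclose (ν m) (hν m)
  have h2 := hclose μ hμ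
  rw [dist_comm] at h2
  have h3 := hN m hm
  linarith [dist_triangle4 (∫ z, f z ∂(ν m : Measure ℂ)) (∫ z, G z ∂(ν m : Measure ℂ))
    (∫ z, G z ∂(μ : Measure ℂ)) (∫ z, f z ∂(μ : Measure ℂ))]

/-! ### Moments of the uniform law on the circle. -/

theorem integral_uniformCircle {E : Type*} [NormedAddCommGroup E] [NormedSpace ℝ E] {f : ℂ → E}
    (hf : Continuous f) : ∫ z, f z ∂(uniformCircle : Measure ℂ) =
      (2 * Real.pi)⁻¹ • ∫ θ in (0 : ℝ)..(2 * Real.pi), f (Complex.exp (θ * Complex.I)) := by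
  have hpi := Real.pi_pos
  change ∫ z, f z ∂((volume[|Set.Ioc (0 : ℝ) (2 * Real.pi)]).map
    (fun θ : ℝ => Complex.exp (θ * Complex.I))) = _
  rw [integral_map (by fun_prop) hf.aestronglyMeasurable, ProbabilityTheory.cond,
    integral_smul_measure, intervalIntegral.integral_of_le (by positivity)]
  congr 1
  simp [ENNReal.toReal_ofReal, hpi.le]

theorem integral_zpow_uniformCircle (f : ℂ → ℂ) (hf : Continuous f) (j : ℤ)
    (h : ∀ θ : ℝ, f (Complex.exp (θ * Complex.I)) = Complex.exp (j * Complex.I * θ)) :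
    ∫ z, f z ∂(uniformCircle : Measure ℂ) = if j = 0 then 1 else 0 := by
  rw [integral_uniformCircle hf]
  simp only [h]
  have hpi := Real.pi_pos
  split_ifs with hj
  · subst hj
    have : (Real.pi : ℂ) ≠ 0 := by exact_mod_cast hpi.ne'
    simp
    field_simp
  · rw [integral_exp_mul_complex (by simp [hj])]
    have : Complex.exp (j * Complex.I * (2 * Real.pi : ℝ)) = 1 :=
      Complex.exp_eq_one_iff.2 ⟨j, by push_cast; ring⟩
    rw [this]
    simp

theorem integral_moment_uniformCircle (a b : ℕ) :
    ∫ z, z ^ a * (starRingEnd ℂ z) ^ b ∂(uniformCircle : Measure ℂ) = if a = b then 1 else 0 := by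
  rw [integral_zpow_uniformCircle _ (by fun_prop) (a - b : ℤ)]
  · simp [sub_eq_zero]
  · intro θ
    rw [← Complex.exp_conj, ← Complex.exp_nat_mul, ← Complex.exp_nat_mul, ← Complex.exp_add]
    congr 1
    simp
    ring

theorem ae_norm_eq_one_uniformCircle : ∀ᵐ z ∂(uniformCircle : Measure ℂ), ‖z‖ = 1 := by
  change ∀ᵐ z ∂((volume[|Set.Ioc (0 : ℝ) (2 * Real.pi)]).map
    (fun θ : ℝ => Complex.exp (θ * Complex.I))), ‖z‖ = 1
  rw [ae_map_iff (by fun_prop) (measurableSet_eq_fun (by fun_prop) (by fun_prop))]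
  exact Eventually.of_forall fun θ => Complex.norm_exp_ofReal_mul_I θ

/-! ### Zeros of iterated derivatives: location and power sums. -/

theorem norm_le_one_of_mem_roots_derivative {p : ℂ[X]} (h : ∀ a ∈ p.roots, ‖a‖ ≤ 1) :
    ∀ a ∈ p.derivative.roots, ‖a‖ ≤ 1 := by
  intro a ha
  have hd : 0 < p.degree := by
    by_contra hd
    rw [eq_C_of_degree_le_zero (not_lt.1 hd)] at ha
    simp at ha
  have hmem : a ∈ p.derivative.rootSet ℂ := by
    rw [mem_rootSet]
    obtain ⟨h0, h1⟩ := mem_roots'.1 ha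
    exact ⟨h0, by simpa using h1⟩
  have hsub : p.rootSet ℂ ⊆ Metric.closedBall 0 1 := by
    intro z hz
    rw [mem_rootSet] at hz
    rw [mem_closedBall_zero_iff]
    exact h z (mem_roots'.2 ⟨hz.1, by simpa using hz.2⟩)
  have := convexHull_min hsub (convex_closedBall 0 1)
    (rootSet_derivative_subset_convexHull_rootSet hd hmem)
  simpa using this

theorem norm_le_one_of_mem_roots_iterate_derivative {p : ℂ[X]} (h : ∀ a ∈ p.roots, ‖a‖ ≤ 1)
    (k : ℕ) : ∀ a ∈ (derivative^[k] p).roots, ‖a‖ ≤ 1 := by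
  induction k with
  | zero => exact h
  | succ k ih =>
    rw [Function.iterate_succ_apply']
    exact norm_le_one_of_mem_roots_derivative ih

theorem natDegree_iterate_derivative_eq (p : ℂ[X]) (k : ℕ) :
    (derivative^[k] p).natDegree = p.natDegree - k := by
  induction k with
  | zero => rfl
  | succ k ih => rw [Function.iterate_succ_apply', natDegree_derivative, ih, Nat.sub_sub]

theorem norm_powSum_roots_iterate_derivative_sub_le (k : ℕ) {m : ℕ} (hm : 1 ≤ m) :
    ∃ c : ℝ, ∀ p : ℂ[X], k ≤ p.natDegree → (∀ a ∈ p.roots, ‖a‖ ≤ 1) →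
      ‖powSum p.roots m - powSum (derivative^[k] p).roots m‖ ≤ c := by
  induction k with
  | zero => exact ⟨0, by simp⟩
  | succ k ih =>
    obtain ⟨c, hc⟩ := ih
    obtain ⟨d, hd⟩ := norm_powSum_roots_sub_le m
    refine ⟨c + d, fun p hp h => ?_⟩
    have h1 := hc p (by omega) h
    have h2 := hd (derivative^[k] p) (by rw [natDegree_iterate_derivative_eq]; omega)
      (norm_le_one_of_mem_roots_iterate_derivative h k) m le_rfl hm
    rw [Function.iterate_succ_apply']
    linarith [norm_sub_le_norm_sub_add_norm_sub (powSum p.roots m)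
      (powSum (derivative^[k] p).roots m) (powSum (derivative (derivative^[k] p)).roots m)]

/-! ### Distance of the zeros to the circle, and mixed moments. -/

/-- Factor by factor, `‖a‖ ≤ exp (-(1 - ‖a‖))`. -/
theorem norm_prod_le_exp (s : Multiset ℂ) :
    ‖s.prod‖ ≤ Real.exp (-(s.map fun a => 1 - ‖a‖).sum) := by
  induction s using Multiset.induction_on with
  | empty => simp
  | cons a s ih =>
    rw [Multiset.prod_cons, norm_mul, Multiset.map_cons, Multiset.sum_cons, neg_add, Real.exp_add]
    refine mul_le_mul ?_ ih (norm_nonneg _) (Real.exp_pos _).le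
    linarith [Real.add_one_le_exp (-(1 - ‖a‖))]

theorem sum_one_sub_norm_nonneg {s : Multiset ℂ} (h : ∀ a ∈ s, ‖a‖ ≤ 1) :
    0 ≤ (s.map fun a => 1 - ‖a‖).sum := by
  apply Multiset.sum_nonneg
  simp only [Multiset.mem_map]
  rintro _ ⟨a, ha, rfl⟩
  linarith [h a ha]

/-- The mixed moment sum `∑ w ^ a * conj w ^ b` over a multiset. -/
noncomputable def momentSum (s : Multiset ℂ) (a b : ℕ) : ℂ :=
  (s.map fun z => z ^ a * (starRingEnd ℂ z) ^ b).sum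

theorem momentSum_cons (z : ℂ) (s : Multiset ℂ) (a b : ℕ) :
    momentSum (z ::ₘ s) a b = z ^ a * (starRingEnd ℂ z) ^ b + momentSum s a b := by
  simp [momentSum]

theorem momentSum_comm (s : Multiset ℂ) (a b : ℕ) :
    momentSum s a b = starRingEnd ℂ (momentSum s b a) := by
  induction s using Multiset.induction_on with
  | empty => simp [momentSum]
  | cons z s ih => simp [momentSum_cons, ih, mul_comm]

/-- Each term differs from `z ^ j` by the factor `‖z‖ ^ (2 * b)`, and Bernoulli gives `1 - ‖z‖ ^ (2
* b) ≤ 2 * b * (1 - ‖z‖)`. -/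
theorem norm_momentSum_sub_powSum_le {s : Multiset ℂ} (h : ∀ a ∈ s, ‖a‖ ≤ 1) (j b : ℕ) :
    ‖momentSum s (j + b) b - powSum s j‖ ≤ (2 * b : ℕ) * (s.map fun a => 1 - ‖a‖).sum := by
  induction s using Multiset.induction_on with
  | empty => simp [momentSum, powSum]
  | cons z s ih =>
    have h1 := ih fun a ha => h a (by simp [ha])
    have hz := h z (by simp)
    have h2 : ‖z ^ (j + b) * (starRingEnd ℂ z) ^ b - z ^ j‖ ≤ (2 * b : ℕ) * (1 - ‖z‖) := by
      have h3 : z ^ (j + b) * (starRingEnd ℂ z) ^ b - z ^ j =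
          -(z ^ j * ((1 - ‖z‖ ^ (2 * b) : ℝ) : ℂ)) := by
        rw [pow_add, mul_assoc, ← mul_pow, Complex.mul_conj, Complex.normSq_eq_norm_sq]
        push_cast
        ring
      have h4 : ‖z‖ ^ (2 * b) ≤ 1 := pow_le_one₀ (norm_nonneg _) hz
      have h5 := one_add_mul_le_pow (a := ‖z‖ - 1) (by linarith [norm_nonneg z]) (2 * b)
      rw [add_sub_cancel] at h5
      rw [h3, norm_neg, norm_mul, norm_pow, Complex.norm_real, Real.norm_of_nonneg (by linarith)]
      have h6 : ‖z‖ ^ j ≤ 1 := pow_le_one₀ (norm_nonneg _) hz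
      nlinarith
    rw [momentSum_cons, powSum_cons, Multiset.map_cons, Multiset.sum_cons, mul_add,
      add_sub_add_comm]
    exact (norm_add_le _ _).trans (add_le_add h2 h1)

/-! ### Empirical measures and the deterministic convergence criterion. -/

theorem integral_sum_dirac (s : Multiset ℂ) (f : ℂ → ℂ) :
    Integrable f (s.map Measure.dirac).sum ∧
      ∫ z, f z ∂(s.map Measure.dirac).sum = (s.map f).sum := by
  induction s using Multiset.induction_on with
  | empty => simp
  | cons a s ih =>
    have ha : Integrable f (Measure.dirac a) := integrable_dirac (by simp)
    simp only [Multiset.map_cons, Multiset.sum_cons]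
    exact ⟨ha.add_measure ih.1, by rw [integral_add_measure ha ih.1, ih.2, integral_dirac]⟩

section

variable {Ω : Type*} (Z : ℕ → Ω → ℂ) (k : ℕ) (ω : Ω)

theorem integral_empiricalMeasure {n : ℕ} (hkn : k < n) (f : ℂ → ℂ) :
    ∫ z, f z ∂(empiricalMeasure Z k n hkn ω : Measure ℂ) =
      ((n - k : ℕ) : ℂ)⁻¹ * ((derivZeros Z k n ω).map f).sum := by
  change ∫ z, f z ∂(((n - k : ℕ) : ENNReal)⁻¹ • ((derivZeros Z k n ω).map Measure.dirac).sum) = _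
  rw [integral_smul_measure, (integral_sum_dirac _ f).2, ENNReal.toReal_inv,
    ENNReal.toReal_natCast, Complex.real_smul]
  push_cast
  rfl

theorem ae_empiricalMeasure {n : ℕ} (hkn : k < n) {K : Set ℂ} (hK : MeasurableSet K)
    (h : ∀ a ∈ derivZeros Z k n ω, a ∈ K) :
    ∀ᵐ z ∂(empiricalMeasure Z k n hkn ω : Measure ℂ), z ∈ K := by
  change ∀ᵐ z ∂(((n - k : ℕ) : ENNReal)⁻¹ • ((derivZeros Z k n ω).map Measure.dirac).sum), z ∈ K
  apply Measure.ae_smul_measure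
  generalize derivZeros Z k n ω = s at h
  induction s using Multiset.induction_on with
  | empty => simp
  | cons a s ih =>
    simp only [Multiset.map_cons, Multiset.sum_cons]
    rw [ae_add_measure_iff]
    exact ⟨(ae_dirac_iff hK).2 (h a (by simp)), ih fun b hb => h b (by simp [hb])⟩

theorem natDegree_randomPoly (n : ℕ) : (randomPoly Z n ω).natDegree = n := by
  simp [randomPoly]

theorem monic_randomPoly (n : ℕ) : (randomPoly Z n ω).Monic :=
  monic_prod_of_monic _ _ fun _ _ => monic_X_sub_C _

theorem roots_randomPoly (n : ℕ) :
    (randomPoly Z n ω).roots = (Multiset.range n).map fun i => Z i ω := by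
  rw [randomPoly, roots_prod _ _ (monic_randomPoly Z ω n).ne_zero]
  simp [Multiset.bind_singleton]

theorem norm_le_one_of_mem_derivZeros (hZ : ∀ i, ‖Z i ω‖ ≤ 1) (n : ℕ) :
    ∀ a ∈ derivZeros Z k n ω, ‖a‖ ≤ 1 := by
  apply norm_le_one_of_mem_roots_iterate_derivative
  rw [roots_randomPoly]
  simp only [Multiset.mem_map]
  rintro _ ⟨i, _, rfl⟩
  exact hZ i

/-- Vieta for the `k`-th derivative, whose constant term is `k!` times the coefficient and whose
leading coefficient is `n (n - 1) ⋯ (n - k + 1) ≤ n ^ k`. -/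
theorem norm_coeff_randomPoly_le {n : ℕ} (hkn : k ≤ n) :
    ‖(randomPoly Z n ω).coeff k‖ ≤ n ^ k * ‖(derivZeros Z k n ω).prod‖ := by
  have h := (IsAlgClosed.splits
    (derivative^[k] (randomPoly Z n ω))).coeff_zero_eq_leadingCoeff_mul_prod_roots
  have hm : (randomPoly Z n ω).coeff n = 1 := by
    have := (monic_randomPoly Z ω n).coeff_natDegree
    rwa [natDegree_randomPoly] at this
  rw [leadingCoeff, natDegree_iterate_derivative_eq, coeff_iterate_derivative,
    coeff_iterate_derivative, natDegree_randomPoly, Nat.sub_add_cancel hkn, hm, zero_add,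
    Nat.descFactorial_self] at h
  have h1 := congrArg norm h
  simp only [nsmul_eq_mul, norm_mul, Complex.norm_natCast, mul_one, norm_pow, norm_neg, norm_one,
    one_pow, one_mul] at h1
  have h2 : (1 : ℝ) ≤ (k.factorial : ℝ) := by exact_mod_cast Nat.factorial_pos k
  have h3 : (n.descFactorial k : ℝ) ≤ (n : ℝ) ^ k := by exact_mod_cast Nat.descFactorial_le_pow n k
  calc _ ≤ (k.factorial : ℝ) * ‖(randomPoly Z n ω).coeff k‖ :=
        le_mul_of_one_le_left (norm_nonneg _) h2
    _ = _ := h1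
    _ ≤ _ := mul_le_mul_of_nonneg_right h3 (norm_nonneg _)

variable {Z k ω}

/-- Taking logarithms in Vieta's bound gives `∑ (1 - ‖w‖) ≤ k log n + ε n / 2`, and `log n / n`
tends to 0. -/
theorem tendsto_sum_one_sub_norm_derivZeros (hZ : ∀ i, ‖Z i ω‖ ≤ 1)
    (hcoeff : ∀ ε > 0, ∀ᶠ n : ℕ in atTop,
      Real.exp (-(ε * n)) ≤ ‖(randomPoly Z n ω).coeff k‖) :
    Tendsto (fun n : ℕ => ((derivZeros Z k n ω).map fun a => 1 - ‖a‖).sum / n) atTop (𝓝 0) := by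
  have hlog : Tendsto (fun n : ℕ => k * (Real.log n / n)) atTop (𝓝 0) := by
    have : Tendsto (fun x : ℝ => Real.log x / x) atTop (𝓝 0) :=
      Real.isLittleO_log_id_atTop.tendsto_div_nhds_zero
    simpa using (this.comp tendsto_natCast_atTop_atTop).const_mul (k : ℝ)
  rw [Metric.tendsto_atTop']
  intro ε hε
  have hev := (hcoeff (ε / 2) (by positivity)).and
    ((hlog.eventually (gt_mem_nhds (by positivity : 0 < ε / 2))).and
    ((eventually_ge_atTop k).and (eventually_gt_atTop 0)))
  obtain ⟨N, hN⟩ := eventually_atTop.1 hev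
  refine ⟨N, fun n hn => ?_⟩
  obtain ⟨h1, h2, h3, h4⟩ := hN n hn.le
  have hn0 : (0 : ℝ) < n := by exact_mod_cast h4
  have hS := sum_one_sub_norm_nonneg (norm_le_one_of_mem_derivZeros Z k ω hZ n)
  rw [Real.dist_0_eq_abs, abs_of_nonneg (by positivity), div_lt_iff₀ hn0]
  have h5 := h1.trans (norm_coeff_randomPoly_le Z k ω h3)
  have h6 := h5.trans (mul_le_mul_of_nonneg_left (norm_prod_le_exp _) (by positivity))
  rw [← Real.exp_log (pow_pos hn0 k), ← Real.exp_add, Real.exp_le_exp, Real.log_pow] at h6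
  have h7 : k * Real.log n < ε / 2 * n := by
    rw [← mul_div_assoc, div_lt_iff₀ hn0] at h2
    exact h2
  linarith

theorem tendsto_powSum_derivZeros (hZ : ∀ i, ‖Z i ω‖ ≤ 1)
    (hpow : ∀ m : ℕ, 1 ≤ m →
      Tendsto (fun n : ℕ => (n : ℝ)⁻¹ • ∑ i ∈ Finset.range n, Z i ω ^ m) atTop (𝓝 0))
    {m : ℕ} (hm : 1 ≤ m) :
    Tendsto (fun n : ℕ => powSum (derivZeros Z k n ω) m / n) atTop (𝓝 0) := by
  obtain ⟨c, hc⟩ := norm_powSum_roots_iterate_derivative_sub_le k hm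
  have h1 : Tendsto (fun n : ℕ => (powSum (randomPoly Z n ω).roots m -
      powSum (derivZeros Z k n ω) m) / n) atTop (𝓝 0) := by
    refine squeeze_zero_norm' ?_ (tendsto_const_div_atTop_nhds_zero_nat c)
    filter_upwards [eventually_ge_atTop k] with n hn
    rw [norm_div, Complex.norm_natCast]
    gcongr
    refine hc _ (by rwa [natDegree_randomPoly]) ?_
    -- The zeroth derivative is the polynomial itself.
    exact norm_le_one_of_mem_derivZeros Z 0 ω hZ n
  have h2 := (hpow m hm).sub h1
  rw [sub_zero] at h2
  refine h2.congr fun n => ?_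
  have : powSum (randomPoly Z n ω).roots m = ∑ i ∈ Finset.range n, Z i ω ^ m := by
    rw [roots_randomPoly, powSum, Multiset.map_map]; rfl
  rw [this, Complex.real_smul]
  push_cast
  ring

theorem tendsto_momentSum_derivZeros (hZ : ∀ i, ‖Z i ω‖ ≤ 1)
    (hpow : ∀ m : ℕ, 1 ≤ m →
      Tendsto (fun n : ℕ => (n : ℝ)⁻¹ • ∑ i ∈ Finset.range n, Z i ω ^ m) atTop (𝓝 0))
    (hcoeff : ∀ ε > 0, ∀ᶠ n : ℕ in atTop,
      Real.exp (-(ε * n)) ≤ ‖(randomPoly Z n ω).coeff k‖) (a b : ℕ) :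
    Tendsto (fun n : ℕ => ((n - k : ℕ) : ℂ)⁻¹ * momentSum (derivZeros Z k n ω) a b) atTop
      (𝓝 (if a = b then 1 else 0)) := by
  wlog hab : b ≤ a generalizing a b
  · have h := (Complex.continuous_conj.tendsto _).comp (this b a (by omega))
    rw [if_neg (by omega)] at h
    rw [if_neg (by omega)]
    rw [map_zero] at h
    refine h.congr fun n => ?_
    simp [momentSum_comm _ a b]
  obtain ⟨j, rfl⟩ := Nat.exists_eq_add_of_le' hab
  have h1 : Tendsto (fun n : ℕ => (momentSum (derivZeros Z k n ω) (j + b) b -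
      powSum (derivZeros Z k n ω) j) / n) atTop (𝓝 0) := by
    have h := (tendsto_sum_one_sub_norm_derivZeros hZ hcoeff).const_mul ((2 * b : ℕ) : ℝ)
    rw [mul_zero] at h
    refine squeeze_zero_norm (fun n => ?_) h
    rw [norm_div, Complex.norm_natCast, ← mul_div_assoc]
    gcongr
    exact norm_momentSum_sub_powSum_le (norm_le_one_of_mem_derivZeros Z k ω hZ n) j b
  -- Passes from normalisation by `n` to normalisation by the number `n - k` of zeros.
  have hratio : Tendsto (fun n : ℕ => (n : ℂ) / (n - k : ℕ)) atTop (𝓝 1) := by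
    rw [← tendsto_add_atTop_iff_nat k]
    simp only [Nat.add_sub_cancel]
    have h := (tendsto_const_div_atTop_nhds_zero_nat (k : ℂ)).const_add 1
    rw [add_zero] at h
    refine h.congr' ?_
    filter_upwards [eventually_gt_atTop 0] with n hn
    have : (n : ℂ) ≠ 0 := by exact_mod_cast hn.ne'
    push_cast
    field_simp
  rcases Nat.eq_zero_or_pos j with rfl | hj
  · rw [if_pos (by omega)]
    have h := (h1.mul hratio).const_add 1
    rw [zero_mul, add_zero] at h
    refine h.congr' ?_
    filter_upwards [eventually_gt_atTop k] with n hn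
    have hn0 : (n : ℂ) ≠ 0 := by exact_mod_cast (by omega : n ≠ 0)
    have hnk : ((n - k : ℕ) : ℂ) ≠ 0 := by exact_mod_cast (by omega : n - k ≠ 0)
    rw [powSum_zero, card_derivZeros]
    field_simp
    ring
  · rw [if_neg (by omega)]
    have h := (h1.add (tendsto_powSum_derivZeros (k := k) hZ hpow hj)).mul hratio
    rw [zero_add, zero_mul] at h
    refine h.congr' ?_
    filter_upwards [eventually_gt_atTop k] with n hn
    have hn0 : (n : ℂ) ≠ 0 := by exact_mod_cast (by omega : n ≠ 0)
    have hnk : ((n - k : ℕ) : ℂ) ≠ 0 := by exact_mod_cast (by omega : n - k ≠ 0)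
    field_simp
    ring

theorem tendsto_empiricalMeasure (hZ : ∀ i, ‖Z i ω‖ ≤ 1)
    (hpow : ∀ m : ℕ, 1 ≤ m →
      Tendsto (fun n : ℕ => (n : ℝ)⁻¹ • ∑ i ∈ Finset.range n, Z i ω ^ m) atTop (𝓝 0))
    (hcoeff : ∀ ε > 0, ∀ᶠ n : ℕ in atTop,
      Real.exp (-(ε * n)) ≤ ‖(randomPoly Z n ω).coeff k‖)
    (hk : ∀ m, k < k + 1 + m) :
    Tendsto (fun m : ℕ => empiricalMeasure Z k (k + 1 + m) (hk m) ω) atTop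
      (𝓝 uniformCircle) := by
  apply tendsto_probabilityMeasure_of_tendsto_moments (isCompact_closedBall (0 : ℂ) 1)
  · intro m
    refine ae_empiricalMeasure Z k ω _ Metric.isClosed_closedBall.measurableSet fun a ha => ?_
    simpa using norm_le_one_of_mem_derivZeros Z k ω hZ _ a ha
  · filter_upwards [ae_norm_eq_one_uniformCircle] with z hz
    simp [hz]
  · intro a b
    rw [integral_moment_uniformCircle]
    have h := (tendsto_momentSum_derivZeros hZ hpow hcoeff a b).comp
      (tendsto_add_atTop_nat (k + 1))
    refine h.congr fun m => ?_
    rw [integral_empiricalMeasure, Function.comp_apply, momentSum,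
      add_comm m]

end

/-! ### Anti-concentration on the circle. -/

theorem uniformCircle_closedBall_le {w : ℂ} (hw : ‖w‖ = 1) {δ : ℝ} (hδ : 0 ≤ δ) :
    (uniformCircle : Measure ℂ) (Metric.closedBall w (2 * δ)) ≤ ENNReal.ofReal (2 * δ) := by
  have hpi := Real.pi_pos
  change ((volume[|Set.Ioc (0 : ℝ) (2 * Real.pi)]).map
    (fun θ : ℝ => Complex.exp (θ * Complex.I))) _ ≤ _
  rw [Measure.map_apply (by fun_prop) Metric.isClosed_closedBall.measurableSet,
    cond_apply measurableSet_Ioc]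
  set φ := Complex.arg w
  have hwφ : w = Complex.exp (φ * Complex.I) := by
    have := Complex.norm_mul_exp_arg_mul_I w
    rw [hw] at this
    simpa using this.symm
  -- The chord has length `2 |sin ((θ - φ) / 2)|`, and Jordan's inequality turns this into an angle
  -- of at most `π δ`. Two intervals are needed because `φ` is in `(-π, π]` while `θ` is in `(0,
  -- 2π]`.
  have hsub : Set.Ioc (0 : ℝ) (2 * Real.pi) ∩ (fun θ : ℝ => Complex.exp (θ * Complex.I)) ⁻¹'
      Metric.closedBall w (2 * δ) ⊆ Set.Icc (φ - Real.pi * δ) (φ + Real.pi * δ) ∪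
        Set.Icc (φ + 2 * Real.pi - Real.pi * δ) (φ + 2 * Real.pi + Real.pi * δ) := by
    rintro θ ⟨⟨h0, h1⟩, hθ⟩
    have h2 : |Real.sin ((θ - φ) / 2)| ≤ δ := by
      have h3 : Complex.exp (θ * Complex.I) - w =
          Complex.exp (φ * Complex.I) * (Complex.exp (Complex.I * (θ - φ : ℝ)) - 1) := by
        rw [mul_sub, ← Complex.exp_add, mul_one, ← hwφ]
        congr 2
        push_cast
        ring
      rw [Set.mem_preimage, mem_closedBall_iff_norm, h3, norm_mul, Complex.norm_exp_ofReal_mul_I,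
        one_mul, Complex.norm_exp_I_mul_ofReal_sub_one, norm_mul, Real.norm_ofNat,
        Real.norm_eq_abs] at hθ
      linarith
    have hφ1 := Complex.neg_pi_lt_arg w
    have hφ2 := Complex.arg_le_pi w
    have bound : ∀ x : ℝ, |x| ≤ Real.pi / 2 → |Real.sin x| ≤ δ → |x| ≤ Real.pi * δ / 2 := by
      intro x hx hs
      have h := (Real.mul_abs_le_abs_sin hx).trans hs
      rw [div_mul_eq_mul_div, div_le_iff₀ hpi] at h
      linarith
    rcases le_total ((θ - φ) / 2) (Real.pi / 2) with h | h
    · left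
      have := abs_le.1 (bound ((θ - φ) / 2) (abs_le.2 ⟨by linarith, h⟩) h2)
      exact ⟨by linarith, by linarith⟩
    · right
      have := abs_le.1 (bound ((θ - φ) / 2 - Real.pi) (abs_le.2 ⟨by linarith, by linarith⟩)
        (by rwa [Real.sin_sub_pi, abs_neg]))
      exact ⟨by linarith, by linarith⟩
  calc _ ≤ (volume (Set.Ioc (0 : ℝ) (2 * Real.pi)))⁻¹ *
        (volume (Set.Icc (φ - Real.pi * δ) (φ + Real.pi * δ)) +
        volume (Set.Icc (φ + 2 * Real.pi - Real.pi * δ) (φ + 2 * Real.pi + Real.pi * δ))) := by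
        gcongr
        exact (measure_mono hsub).trans (measure_union_le _ _)
    _ = ENNReal.ofReal (2 * δ) := by
        rw [Real.volume_Ioc, Real.volume_Icc, Real.volume_Icc,
          ← ENNReal.ofReal_add (by nlinarith) (by nlinarith),
          ← ENNReal.ofReal_inv_of_pos (by linarith),
          ← ENNReal.ofReal_mul (inv_nonneg.2 (by linarith))]
        congr 1
        field_simp
        ring

/-- Comparing two points `z`, `w` of the set on the circle eliminates `a`: `b (z - w) = z (b - w a)
- w (b - z a)` gives `‖b‖ ‖z - w‖ ≤ 2 δ²`, so `z` lies within `2 δ` of `w`. No bound on `a` is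
needed. -/
theorem uniformCircle_norm_sub_mul_le (a b : ℂ) {δ : ℝ} (hδ : 0 < δ) (hb : δ ≤ ‖b‖) :
    (uniformCircle : Measure ℂ) {z | ‖b - z * a‖ ≤ δ ^ 2} ≤ ENNReal.ofReal (2 * δ) := by
  by_cases hne : ∃ w : ℂ, ‖w‖ = 1 ∧ ‖b - w * a‖ ≤ δ ^ 2
  · obtain ⟨w, hw, hwa⟩ := hne
    refine (measure_mono_ae ?_).trans (uniformCircle_closedBall_le hw hδ.le)
    filter_upwards [ae_norm_eq_one_uniformCircle] with z hz hza
    have h1 : b * (z - w) = z * (b - w * a) - w * (b - z * a) := by ring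
    have h2 : ‖b‖ * ‖z - w‖ ≤ δ ^ 2 + δ ^ 2 := by
      rw [← norm_mul, h1]
      refine (norm_sub_le _ _).trans ?_
      rw [norm_mul, norm_mul, hz, hw, one_mul, one_mul]
      exact add_le_add hwa hza
    change z ∈ Metric.closedBall w (2 * δ)
    rw [mem_closedBall_iff_norm]
    have h3 : δ * ‖z - w‖ ≤ δ * (2 * δ) :=
      (mul_le_mul_of_nonneg_right hb (norm_nonneg _)).trans (h2.trans (by ring_nf; rfl))
    exact le_of_mul_le_mul_left h3 hδ
  · push Not at hne
    have : (uniformCircle : Measure ℂ) {z | ‖b - z * a‖ ≤ δ ^ 2} = 0 := by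
      refine measure_mono_null ?_ (ae_iff.1 ae_norm_eq_one_uniformCircle)
      intro z hz hz1
      exact absurd hz (not_le.2 (hne z hz1))
    rw [this]
    exact bot_le

theorem measurable_coeff_prod_X_sub_C {α ι : Type*} [MeasurableSpace α] (s : Finset ι)
    {g : ι → α → ℂ} (hg : ∀ i, Measurable (g i)) (k : ℕ) :
    Measurable fun a => (∏ i ∈ s, (X - C (g i a))).coeff k := by
  classical
  induction s using Finset.induction_on generalizing k with
  | empty => simp
  | insert i s hi ih =>
    simp only [Finset.prod_insert hi, sub_mul, coeff_sub, coeff_C_mul]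
    refine Measurable.sub ?_ ((hg i).mul (ih k))
    rcases k with _ | k
    · simp
    · simpa only [coeff_X_mul] using ih k

/-! ### Lower bounds for the coefficients and the law of large numbers. -/

section

variable {Ω : Type*} [MeasurableSpace Ω] {P : Measure Ω}
  {Z : ℕ → Ω → ℂ}

theorem indepFun_coeff_randomPoly [IsProbabilityMeasure P]
    (hZ : ∀ i, Measurable (Z i)) (hindep : iIndepFun Z P)
    (n j k : ℕ) :
    IndepFun (fun ω => ((randomPoly Z n ω).coeff j, (randomPoly Z n ω).coeff k)) (Z n) P := by
  have h := hindep.indepFun_finset (Finset.range n) {n} (by simp) hZ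
  let c : ℕ → ((i : Finset.range n) → ℂ) → ℂ := fun k x =>
    (∏ i : Finset.range n, (X - C (x i))).coeff k
  have hc : ∀ k, Measurable (c k) := fun k =>
    measurable_coeff_prod_X_sub_C Finset.univ (fun i => measurable_pi_apply i) k
  have h2 := h.comp (φ := fun x => (c j x, c k x)) (ψ := fun x => x ⟨n, Finset.mem_singleton_self n⟩)
    ((hc j).prodMk (hc k)) (measurable_pi_apply (X := fun _ : ({n} : Finset ℕ) => ℂ)
      ⟨n, Finset.mem_singleton_self n⟩)
  have hcoeff : ∀ k ω, c k (fun i => Z i ω) = (randomPoly Z n ω).coeff k := fun k ω => by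
    simp only [c, randomPoly]
    rw [Finset.prod_coe_sort (Finset.range n) fun i => X - C (Z i ω)]
  convert h2 using 1
  ext ω
  · exact (hcoeff j ω).symm
  · exact (hcoeff k ω).symm
  · rfl

theorem ae_norm_eq_one (hZ : ∀ i, Measurable (Z i))
    (hlaw : ∀ i, P.map (Z i) = (uniformCircle : Measure ℂ)) : ∀ᵐ ω ∂P, ∀ i, ‖Z i ω‖ = 1 := by
  rw [ae_all_iff]
  intro i
  have h := ae_norm_eq_one_uniformCircle
  rw [← hlaw i] at h
  exact ae_of_ae_map (hZ i).aemeasurable h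

/-- Induction on `k` through `coeff (k+1) P_{n+1} = coeff k P_n - Z n * coeff (k+1) P_n`, where `Z
n` is independent of both coefficients of `P_n`. Off the event that `coeff k P_n` is at most `η = δ
^ 2 ^ k`, the circle estimate at scale `η` applies conditionally. It costs probability `2 η ≤ 2 δ`
and squares the threshold, whence the exponent `2 ^ k`. -/
theorem measure_norm_coeff_randomPoly_le [IsProbabilityMeasure P]
    (hZ : ∀ i, Measurable (Z i)) (hindep : iIndepFun Z P)
    (hlaw : ∀ i, P.map (Z i) = (uniformCircle : Measure ℂ)) {δ : ℝ} (hδ0 : 0 < δ) (hδ1 : δ < 1)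
    (k n : ℕ) (hkn : k ≤ n) :
    P {ω | ‖(randomPoly Z n ω).coeff k‖ ≤ δ ^ 2 ^ k} ≤ k * ENNReal.ofReal (2 * δ) := by
  induction k generalizing n with
  | zero =>
    rw [Nat.cast_zero, zero_mul, nonpos_iff_eq_zero]
    refine measure_mono_null ?_ (ae_iff.1 (ae_norm_eq_one hZ hlaw))
    intro ω hω h1
    have : ‖(randomPoly Z n ω).coeff 0‖ = 1 := by
      rw [coeff_zero_eq_eval_zero, randomPoly, eval_prod, norm_prod]
      simp [h1]
    rw [Set.mem_ofPred_eq, this] at hω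
    simp only [pow_zero, pow_one] at hω
    linarith
  | succ k ih =>
    obtain ⟨n, rfl⟩ : ∃ m, n = m + 1 := ⟨n - 1, by omega⟩
    set η := δ ^ 2 ^ k with hη
    have hη0 : 0 < η := by positivity
    have hηδ : η ≤ δ := pow_le_of_le_one hδ0.le hδ1.le (by positivity)
    let Y : Ω → ℂ × ℂ := fun ω => ((randomPoly Z n ω).coeff k, (randomPoly Z n ω).coeff (k + 1))
    have hY : Measurable Y := (measurable_coeff_prod_X_sub_C _ hZ k).prodMk
      (measurable_coeff_prod_X_sub_C _ hZ (k + 1))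
    let E : Set ((ℂ × ℂ) × ℂ) := {q | ‖q.1.1 - q.2 * q.1.2‖ ≤ η ^ 2 ∧ η < ‖q.1.1‖}
    have hE : MeasurableSet E := by
      have h1 : Measurable fun q : (ℂ × ℂ) × ℂ => ‖q.1.1 - q.2 * q.1.2‖ := by fun_prop
      have h2 : Measurable fun q : (ℂ × ℂ) × ℂ => ‖q.1.1‖ := by fun_prop
      exact (measurableSet_le h1 measurable_const).inter (measurableSet_lt measurable_const h2)
    have hsub : {ω | ‖(randomPoly Z (n + 1) ω).coeff (k + 1)‖ ≤ δ ^ 2 ^ (k + 1)} ⊆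
        {ω | ‖(randomPoly Z n ω).coeff k‖ ≤ η} ∪ (fun ω => (Y ω, Z n ω)) ⁻¹' E := by
      intro ω hω
      rcases le_or_gt ‖(randomPoly Z n ω).coeff k‖ η with h | h
      · exact Or.inl h
      · refine Or.inr ⟨?_, h⟩
        have hrec : (randomPoly Z (n + 1) ω).coeff (k + 1) =
            (randomPoly Z n ω).coeff k - Z n ω * (randomPoly Z n ω).coeff (k + 1) := by
          rw [randomPoly, Finset.prod_range_succ, mul_sub, coeff_sub, coeff_mul_X, coeff_mul_C,
            mul_comm (Z n ω)]
          rfl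
        rw [Set.mem_ofPred_eq, hrec, pow_succ, pow_mul] at hω
        exact hω
    have hprod : P ((fun ω => (Y ω, Z n ω)) ⁻¹' E) ≤ ENNReal.ofReal (2 * δ) := by
      rw [← Measure.map_apply (hY.prodMk (hZ n)) hE,
        (indepFun_iff_map_prod_eq_prod_map_map hY.aemeasurable (hZ n).aemeasurable).1
          (indepFun_coeff_randomPoly hZ hindep n k (k + 1)), hlaw, Measure.prod_apply hE]
      have : IsProbabilityMeasure (P.map Y) := Measure.isProbabilityMeasure_map hY.aemeasurable
      calc _ ≤ ∫⁻ _, ENNReal.ofReal (2 * δ) ∂(P.map Y) := by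
            refine lintegral_mono fun y => ?_
            rcases le_or_gt ‖y.1‖ η with h | h
            · have : Prod.mk y ⁻¹' E = ∅ := by
                ext z
                simp [E, h]
              rw [this]
              simp
            · refine (measure_mono fun z hz => hz.1).trans
                ((uniformCircle_norm_sub_mul_le y.2 y.1 hη0 h.le).trans ?_)
              exact ENNReal.ofReal_le_ofReal (by linarith)
        _ = _ := by simp
    calc _ ≤ P {ω | ‖(randomPoly Z n ω).coeff k‖ ≤ η} + P ((fun ω => (Y ω, Z n ω)) ⁻¹' E) :=
          (measure_mono hsub).trans (measure_union_le _ _)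
      _ ≤ k * ENNReal.ofReal (2 * δ) + ENNReal.ofReal (2 * δ) :=
          add_le_add (ih n (by omega)) hprod
      _ = _ := by push_cast; ring

theorem ae_eventually_exp_le_norm_coeff [IsProbabilityMeasure P]
    (hZ : ∀ i, Measurable (Z i)) (hindep : iIndepFun Z P)
    (hlaw : ∀ i, P.map (Z i) = (uniformCircle : Measure ℂ)) (k : ℕ) {ε : ℝ} (hε : 0 < ε) :
    ∀ᵐ ω ∂P, ∀ᶠ n : ℕ in atTop, Real.exp (-(ε * n)) ≤ ‖(randomPoly Z n ω).coeff k‖ := by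
  -- Chosen so that `δ = r ^ n` has `δ ^ 2 ^ k = exp (-ε n)`; the resulting probabilities are
  -- geometrically summable and Borel–Cantelli applies.
  set r := Real.exp (-(ε / 2 ^ k)) with hr
  have hr0 : 0 < r := Real.exp_pos _
  have hr1 : r < 1 := Real.exp_lt_one_iff.2 (by simp; positivity)
  have hpow : ∀ n : ℕ, (r ^ n) ^ 2 ^ k = Real.exp (-(ε * n)) := by
    intro n
    rw [hr, ← Real.exp_nat_mul, ← Real.exp_nat_mul]
    congr 1
    push_cast
    field_simp
  -- The shift by `k + 1` ensures both that the degree is at least `k` and that `r ^ (n + (k + 1)) <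
  -- 1`.
  have hle : ∀ n : ℕ, P {ω | ‖(randomPoly Z (n + (k + 1)) ω).coeff k‖ ≤
      Real.exp (-(ε * (n + (k + 1) : ℕ)))} ≤ ENNReal.ofReal (k * (2 * r ^ n)) := by
    intro n
    rw [← hpow]
    refine (measure_norm_coeff_randomPoly_le hZ hindep hlaw (by positivity)
      (pow_lt_one₀ hr0.le hr1 (by omega)) k _ (by omega)).trans ?_
    rw [ENNReal.ofReal_mul (p := (k : ℝ)) (by positivity), ENNReal.ofReal_natCast]
    exact mul_le_mul' le_rfl (ENNReal.ofReal_le_ofReal (mul_le_mul_of_nonneg_left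
      (pow_le_pow_of_le_one hr0.le hr1.le (Nat.le_add_right n (k + 1))) zero_le_two))
  have hsum : ∑' n : ℕ, P {ω | ‖(randomPoly Z (n + (k + 1)) ω).coeff k‖ ≤
      Real.exp (-(ε * (n + (k + 1) : ℕ)))} ≠ ⊤ := by
    refine ne_top_of_le_ne_top ?_ (ENNReal.tsum_le_tsum hle)
    exact (((summable_geometric_of_lt_one hr0.le hr1).mul_left 2).mul_left _).tsum_ofReal_ne_top
  filter_upwards [ae_eventually_notMem hsum] with ω hω
  obtain ⟨N, hN⟩ := eventually_atTop.1 hω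
  refine eventually_atTop.2 ⟨N + (k + 1), fun n hn => ?_⟩
  have h := hN (n - (k + 1)) (by omega)
  rw [Nat.sub_add_cancel (by omega)] at h
  exact (not_le.1 h).le

theorem ae_tendsto_average_pow [IsProbabilityMeasure P]
    (hZ : ∀ i, Measurable (Z i)) (hindep : iIndepFun Z P)
    (hlaw : ∀ i, P.map (Z i) = (uniformCircle : Measure ℂ)) {m : ℕ} (hm : 1 ≤ m) :
    ∀ᵐ ω ∂P, Tendsto (fun n : ℕ => (n : ℝ)⁻¹ • ∑ i ∈ Finset.range n, Z i ω ^ m) atTop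
      (𝓝 0) := by
  have hpow : Measurable fun z : ℂ => z ^ m := by fun_prop
  have hint : Integrable (fun ω => Z 0 ω ^ m) P := by
    refine Integrable.of_bound ((hZ 0).pow_const m).aestronglyMeasurable 1 ?_
    filter_upwards [ae_norm_eq_one hZ hlaw] with ω h
    rw [norm_pow, h, one_pow]
  have h := strong_law_ae (μ := P) (fun i ω => Z i ω ^ m) hint
    (fun i j hij => (hindep.indepFun hij).comp hpow hpow)
    (fun i => (IdentDistrib.mk (hZ i).aemeasurable (hZ 0).aemeasurable
      (by rw [hlaw, hlaw])).comp hpow)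
  have hmean : ∫ ω, Z 0 ω ^ m ∂P = 0 := by
    rw [← integral_map (f := fun z : ℂ => z ^ m) (hZ 0).aemeasurable
      hpow.aestronglyMeasurable, hlaw]
    have := integral_moment_uniformCircle m 0
    rw [if_neg (by omega)] at this
    simpa using this
  rwa [hmean] at h

end

/-! ### Assembly of the almost sure statements. -/

theorem corollary6 {Ω : Type*} [MeasurableSpace Ω] (P : Measure Ω) [IsProbabilityMeasure P]
    (Z : ℕ → Ω → ℂ) (hZ : ∀ i, Measurable (Z i))
    (hindep : iIndepFun Z P)
    (hlaw : ∀ i, P.map (Z i) = (uniformCircle : Measure ℂ))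
    (k : ℕ) (hk : 1 ≤ k) :
    ∀ᵐ ω ∂P, Tendsto
      (fun m : ℕ => empiricalMeasure Z k (k + 1 + m) (by omega) ω) atTop (𝓝 uniformCircle) := by
  have hpow : ∀ᵐ ω ∂P, ∀ m : ℕ, 1 ≤ m →
      Tendsto (fun n : ℕ => (n : ℝ)⁻¹ • ∑ i ∈ Finset.range n, Z i ω ^ m) atTop (𝓝 0) := by
    rw [ae_all_iff]
    intro m
    by_cases hm : 1 ≤ m
    · filter_upwards [ae_tendsto_average_pow hZ hindep hlaw hm] with ω h _ using h
    · exact Eventually.of_forall fun _ h => absurd h hm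
  -- Countably many rates `1 / (q + 1)` stand in for all `ε > 0`, so that a single null set
  -- suffices.
  have hcoeff : ∀ᵐ ω ∂P, ∀ q : ℕ, ∀ᶠ n : ℕ in atTop,
      Real.exp (-(1 / ((q : ℝ) + 1) * n)) ≤ ‖(randomPoly Z n ω).coeff k‖ :=
    ae_all_iff.2 fun q => ae_eventually_exp_le_norm_coeff hZ hindep hlaw k (by positivity)
  filter_upwards [ae_norm_eq_one hZ hlaw, hpow, hcoeff] with ω h1 h2 h3
  refine tendsto_empiricalMeasure (fun i => (h1 i).le) h2 (fun ε hε => ?_) _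
  obtain ⟨q, hq⟩ := exists_nat_one_div_lt hε
  filter_upwards [h3 q] with n hn
  refine le_trans ?_ hn
  gcongr
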